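/- Let $W(E_6^{(1)})=\langle s_0,\dots,s_6\rangle$ be the affine Weyl group (Coxeter group) whose Dynkin diagram has nodes $0,\dots,6$ and single bonds $1{-}2,\ 2{-}3,\ 3{-}4,\ 4{-}5,\ 3{-}6,\ 6{-}0$; let $\sigma$ be the diagram automorphism of order three given on nodes by the permutation $(1\,5\,0)(2\,4\,6)$, and let $\widetilde W(E_6^{(1)})=W(E_6^{(1)})\rtimes\langle\sigma\rangle$ with $\sigma s_i\sigma^{-1}=s_{\sigma(i)}$. It acts on the real vector space $V^{(1)}$ with basis the simple roots $\alpha_0,\dots,\alpha_6$: $s_j$ acts by $\alpha_i\mapsto\alpha_i-a_{ij}\alpha_j$, where $(a_{ij})$ is the Cartan matrix of the diagram, and $\sigma$ by $\alpha_i\mapsto\alpha_{\sigma(i)}$. Let $$J=\{\alpha_0,\alpha_1,\alpha_3,\alpha_5\},\qquad W_J=\langle s_0,s_1,s_3,s_5\rangle,\qquad N_J=\{w\in\widetilde W(E_6^{(1)})\mid wJ=J\},$$ and put $$b_1=s_4s_5s_3s_4,\qquad b_2=s_6s_0s_3s_6,\qquad b_0=s_2s_3s_1s_2 .$$ Then the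 normaliser of $W_J$ in $\widetilde W(E_6^{(1)})$ is $$N(W_J)=N_J\ltimes W_J=\bigl(\langle b_1,b_2,b_0\rangle\rtimes\langle\sigma\rangle\bigr)\ltimes\langle s_0,s_1,s_3,s_5\rangle\;\cong\;\widetilde W(A_2^{(1)})\ltimes W(4A_1),$$ where the semidirect products in the two equalities are internal, with $W_J$ normal in $N(W_J)$ and $\langle b_1,b_2,b_0\rangle$ normal in $N_J=\langle b_1,b_2,b_0\rangle\rtimes\langle\sigma\rangle$. Here $\widetilde W(A_2^{(1)})=W(A_2^{(1)})\rtimes\langle\rho\rangle$ is the extension of the affine Weyl group $W(A_2^{(1)})=\langle r_0,r_1,r_2\rangle$ of the triangle diagram by the order-three rotation $\rho r_j\rho^{-1}=r_{j+1}$ (indices modulo $3$), and $W(4A_1)$ is the Weyl group of the diagram with four nodes and no bonds. The isomorphism can be chosen to send $b_j\mapsto r_j$ $(j=0,1,2)$, $\sigma\mapsto\rho$, and $s_0,s_1,s_3,s_5$ to the four simple generators of $W(4A_1)$. -/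

import Mathlib

noncomputable section

namespace WeylNormalizer

section Diagram

variable {B : Type} [DecidableEq B] (Γ : SimpleGraph B) [DecidableRel Γ.Adj]

/-- The Cartan matrix `(a_ij)` of a simply-laced Dynkin diagram `Γ`. -/
def cartan (i j : B) : ℝ := if i = j then 2 else if Γ.Adj i j then -1 else 0

/-- The Coxeter matrix `(m_ij)` of a simply-laced Dynkin diagram `Γ`: two distinct nodes have
`m_ij = 3` if they are joined by a (single) bond and `m_ij = 2` otherwise. -/
def coxMatrix : CoxeterMatrix B where
  M := Matrix.of fun i j => if i = j then 1 else if Γ.Adj i j then 3 else 2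
  isSymm := Matrix.IsSymm.ext fun i j => by
    simp only [Matrix.of_apply, eq_comm (a := j), Γ.adj_comm j]
  diagonal i := by simp
  off_diagonal i j h := by simp only [Matrix.of_apply, h, if_false]; split_ifs <;> decide

/-- The Weyl group `W(Γ)`: the Coxeter group with generators `s_i`, `i ∈ B`, and the
defining relations `(s_i s_j) ^ m_ij = 1`. -/
abbrev Weyl : Type := (coxMatrix Γ).Group

/-- The generator `s_i` of `W(Γ)`. -/
def gen (i : B) : Weyl Γ := (coxMatrix Γ).simple i

/-! The action on the space `V = (B → ℝ)` spanned by the simple roots. -/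

/-- The simple root `α_i`, a vector of the standard basis of `V`. -/
def root (i : B) : B → ℝ := Pi.single i 1

theorem cartan_comm (i j : B) : cartan Γ i j = cartan Γ j i := by
  simp only [cartan, eq_comm (a := j), Γ.adj_comm j]

/-- The linear form on `V` with `α_i ↦ a_ij`. -/
def coroot [Fintype B] (j : B) : Module.Dual ℝ (B → ℝ) :=
  ∑ i, cartan Γ i j • LinearMap.proj i

theorem coroot_root [Fintype B] (i j : B) : coroot Γ j (root i) = cartan Γ i j := by
  simp [coroot, root, LinearMap.sum_apply, Pi.single_apply]

theorem coroot_self [Fintype B] (i : B) : coroot Γ i (root i) = 2 := by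
  simp [coroot_root, cartan]

/-- The reflection along the simple root `α_j`, i.e. `α_i ↦ α_i - a_ij α_j`. -/
def refl [Fintype B] (j : B) : (B → ℝ) ≃ₗ[ℝ] (B → ℝ) := Module.reflection (coroot_self Γ j)

theorem refl_apply [Fintype B] (j : B) (v : B → ℝ) :
    refl Γ j v = v - coroot Γ j v • root j :=
  Module.reflection_apply _ _

theorem refl_liftable [Fintype B] : (coxMatrix Γ).IsLiftable (refl Γ) := by
  intro i j
  ext1 v
  by_cases h : i = j
  · subst h
    simp only [CoxeterMatrix.diagonal, pow_one, LinearEquiv.mul_apply, refl_apply, map_sub,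
      map_smul, coroot_self, LinearEquiv.coe_one, id]
    module
  · by_cases h' : Γ.Adj i j
    · have h1 : cartan Γ i j = -1 := by simp [cartan, h, h']
      have h2 : cartan Γ j i = -1 := by rw [cartan_comm, h1]
      have h3 : coxMatrix Γ i j = 3 := by simp [coxMatrix, h, h']
      simp only [h3, pow_succ, pow_zero, one_mul,
        LinearEquiv.mul_apply, refl_apply, map_sub, map_smul, coroot_self, coroot_root, h1, h2,
        LinearEquiv.coe_one, id]
      module
    · have h1 : cartan Γ i j = 0 := by simp [cartan, h, h']
      have h2 : cartan Γ j i = 0 := by rw [cartan_comm, h1]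
      have h3 : coxMatrix Γ i j = 2 := by simp [coxMatrix, h, h']
      simp only [h3, pow_succ, pow_zero, one_mul,
        LinearEquiv.mul_apply, refl_apply, map_sub, map_smul, coroot_self, coroot_root, h1, h2,
        LinearEquiv.coe_one, id]
      module

/-- The action of `W(Γ)` on `V`, in which `s_j` acts as the reflection along `α_j`. -/
def weylAct [Fintype B] : Weyl Γ →* ((B → ℝ) ≃ₗ[ℝ] (B → ℝ)) :=
  (coxMatrix Γ).toCoxeterSystem.lift ⟨refl Γ, refl_liftable Γ⟩

theorem weylAct_gen [Fintype B] (i : B) : weylAct Γ (gen Γ i) = refl Γ i :=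
  (coxMatrix Γ).toCoxeterSystem.lift_apply_simple (refl_liftable Γ) i

theorem weyl_hom_ext {G : Type*} [Monoid G] {f₁ f₂ : Weyl Γ →* G}
    (h : ∀ i, f₁ (gen Γ i) = f₂ (gen Γ i)) : f₁ = f₂ :=
  (coxMatrix Γ).toCoxeterSystem.ext_simple h

/-! Diagram automorphisms, acting on `W(Γ)` by permuting the generators and on `V` by
permuting the simple roots. -/

theorem diag_liftable (g : Γ ≃g Γ) :
    (coxMatrix Γ).IsLiftable fun i => gen Γ (g i) := by
  intro i j
  have h : (coxMatrix Γ) i j = (coxMatrix Γ) (g i) (g j) := by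
    simp [coxMatrix, g.map_adj_iff]
  rw [h]
  exact (coxMatrix Γ).toCoxeterSystem.simple_mul_simple_pow (g i) (g j)

/-- The endomorphism of `W(Γ)` with `s_i ↦ s_{g i}`. -/
def diagHom (g : Γ ≃g Γ) : Weyl Γ →* Weyl Γ :=
  (coxMatrix Γ).toCoxeterSystem.lift ⟨_, diag_liftable Γ g⟩

theorem diagHom_gen (g : Γ ≃g Γ) (i : B) : diagHom Γ g (gen Γ i) = gen Γ (g i) :=
  (coxMatrix Γ).toCoxeterSystem.lift_apply_simple (diag_liftable Γ g) i

theorem diagHom_mul (g h : Γ ≃g Γ) : diagHom Γ (g * h) = (diagHom Γ g).comp (diagHom Γ h) :=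
  weyl_hom_ext Γ fun i => by simp [diagHom_gen]

theorem diagHom_one : diagHom Γ 1 = MonoidHom.id _ :=
  weyl_hom_ext Γ fun i => by simp [diagHom_gen]

/-- The action of the diagram automorphisms on `W(Γ)`, with `g · s_i = s_{g i}`. -/
def diagAut : (Γ ≃g Γ) →* MulAut (Weyl Γ) where
  toFun g := MonoidHom.toMulEquiv (diagHom Γ g) (diagHom Γ g⁻¹)
    (by rw [← diagHom_mul, inv_mul_cancel, diagHom_one])
    (by rw [← diagHom_mul, mul_inv_cancel, diagHom_one])
  map_one' := by ext w; simp [diagHom_one]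
  map_mul' g h := by ext w; simp [diagHom_mul]

/-- The action of the diagram automorphisms on `V`, with `g · α_i = α_{g i}`. -/
def diagAct : (Γ ≃g Γ) →* ((B → ℝ) ≃ₗ[ℝ] (B → ℝ)) where
  toFun g := LinearEquiv.funCongrLeft ℝ ℝ (g⁻¹ : Γ ≃g Γ).toEquiv
  map_one' := rfl
  map_mul' g h := by rw [mul_inv_rev]; rfl

theorem diagAct_apply (g : Γ ≃g Γ) (v : B → ℝ) (i : B) : diagAct Γ g v i = v (g⁻¹ i) := rfl

theorem diagAct_root (g : Γ ≃g Γ) (i : B) : diagAct Γ g (root i) = root (g i) := by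
  ext j
  have h : g⁻¹ j = i ↔ j = g i := by
    constructor
    · rintro rfl; exact (RelIso.apply_inv_self g j).symm
    · rintro rfl; exact RelIso.inv_apply_self g i
  simp [diagAct_apply, root, Pi.single_apply, h]

/-! Extended Weyl groups. -/

/-- The extended Weyl group `W(Γ) ⋊ A`, for a group `A` of automorphisms of the diagram `Γ`. -/
abbrev ExtWeyl (A : Subgroup (Γ ≃g Γ)) : Type := Weyl Γ ⋊[(diagAut Γ).comp A.subtype] A

variable (A : Subgroup (Γ ≃g Γ))

/-- The simple reflection `s_i` as an element of `W(Γ) ⋊ A`. -/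
def s (i : B) : ExtWeyl Γ A := SemidirectProduct.inl (gen Γ i)

theorem coroot_diagAct [Fintype B] (g : Γ ≃g Γ) (j : B) (v : B → ℝ) :
    coroot Γ (g j) (diagAct Γ g v) = coroot Γ j v := by
  have h : ∀ i, cartan Γ (g i) (g j) = cartan Γ i j := fun i => by
    simp [cartan, g.map_adj_iff]
  simp only [coroot, LinearMap.sum_apply, LinearMap.smul_apply, LinearMap.proj_apply,
    diagAct_apply]
  rw [← Equiv.sum_comp g.toEquiv]
  refine Finset.sum_congr rfl fun i _ => ?_
  have e : g⁻¹ (g.toEquiv i) = i := RelIso.inv_apply_self g i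
  rw [e]
  exact congrArg (· • v i) (h i)

theorem act_compat [Fintype B] (g : A) :
    (weylAct Γ).comp (((diagAut Γ).comp A.subtype) g).toMonoidHom =
      (MulAut.conj (((diagAct Γ).comp A.subtype) g)).toMonoidHom.comp (weylAct Γ) := by
  refine weyl_hom_ext Γ fun i => ?_
  have h : weylAct Γ (diagHom Γ g (gen Γ i)) =
      diagAct Γ g * weylAct Γ (gen Γ i) * (diagAct Γ g)⁻¹ := by
    rw [diagHom_gen, weylAct_gen, weylAct_gen, eq_mul_inv_iff_mul_eq]
    ext1 v
    simp only [LinearEquiv.mul_apply, refl_apply, map_sub, map_smul, coroot_diagAct, diagAct_root]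
  exact h

/-- The action of `W(Γ) ⋊ A` on `V`: `s_j` acts as the reflection along `α_j`, and `g ∈ A`
permutes the simple roots. -/
def act [Fintype B] : ExtWeyl Γ A →* ((B → ℝ) ≃ₗ[ℝ] (B → ℝ)) :=
  SemidirectProduct.lift (weylAct Γ) ((diagAct Γ).comp A.subtype) (act_compat Γ A)

/-- The standard parabolic subgroup `W_J = ⟨s_i | α_i ∈ J⟩` (with `J` given by its set of
indices). -/
def parabolic (J : Set B) : Subgroup (ExtWeyl Γ A) := Subgroup.closure (s Γ A '' J)

/-- The subgroup `N_J = {w | w J = J}` (with `J` given by its set of indices). -/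
def rootStabilizer [Fintype B] (J : Set B) : Subgroup (ExtWeyl Γ A) where
  carrier := {w | act Γ A w '' (root '' J) = root '' J}
  one_mem' := by simp
  mul_mem' {a b} ha hb := by
    have h : ⇑(act Γ A (a * b)) = act Γ A a ∘ act Γ A b := by rw [map_mul]; rfl
    simp only [Set.mem_ofPred_eq] at ha hb ⊢
    rw [h, Set.image_comp, hb, ha]
  inv_mem' {a} ha := by
    simp only [Set.mem_ofPred_eq] at ha ⊢
    have h : ⇑(act Γ A a⁻¹) ∘ ⇑(act Γ A a) = id := by
      funext v
      change (act Γ A a⁻¹ * act Γ A a) v = v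
      rw [← map_mul, inv_mul_cancel, map_one]
      rfl
    conv_lhs => rw [← ha]
    rw [← Set.image_comp, h, Set.image_id]

end Diagram

/-- `K` is the internal semidirect product of its subgroups `H` and `N`, with `N` normal:
`K = H ⋉ N`. -/
structure IsSemidirect {G : Type*} [Group G] (K H N : Subgroup G) : Prop where
  left_le : H ≤ K
  right_le : N ≤ K
  conj_mem : ∀ k ∈ K, ∀ n ∈ N, k * n * k⁻¹ ∈ N
  inf_eq_bot : H ⊓ N = ⊥
  sup_eq : H ⊔ N = K

/-! The group `W̃(E₆⁽¹⁾)`. -/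

/-- The bonds of the Dynkin diagram of type `E₆⁽¹⁾`: the three arms `1 - 2 - 3`, `5 - 4 - 3`
and `0 - 6 - 3`. -/
def bondsE : List (Fin 7 × Fin 7) := [(1, 2), (2, 3), (5, 4), (4, 3), (0, 6), (6, 3)]

/-- The Dynkin diagram of type `E₆⁽¹⁾`. -/
def diagramE : SimpleGraph (Fin 7) where
  Adj i j := (i, j) ∈ bondsE ∨ (j, i) ∈ bondsE
  symm := ⟨fun _ _ h => h.symm⟩
  loopless := ⟨by decide⟩

instance : DecidableRel diagramE.Adj := fun i j =>
  inferInstanceAs (Decidable ((i, j) ∈ bondsE ∨ (j, i) ∈ bondsE))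

/-- The diagram automorphism `(1 5 0)(2 4 6)` of `E₆⁽¹⁾`. -/
def sigmaDiagE : diagramE ≃g diagramE where
  toFun := ![1, 5, 4, 3, 6, 0, 2]
  invFun := ![5, 0, 6, 3, 2, 1, 4]
  left_inv := by decide
  right_inv := by decide
  map_rel_iff' := by decide

/-- The extended affine Weyl group `W̃(E₆⁽¹⁾) = W(E₆⁽¹⁾) ⋊ ⟨σ⟩`. -/
abbrev ExtE : Type := ExtWeyl diagramE (Subgroup.zpowers sigmaDiagE)

/-- The simple reflections of `W̃(E₆⁽¹⁾)`. -/
def sE (i : Fin 7) : ExtE := s diagramE _ i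

/-- The element `σ` of `W̃(E₆⁽¹⁾)`. -/
def sigmaE : ExtE := SemidirectProduct.inr ⟨sigmaDiagE, Subgroup.mem_zpowers _⟩

/-- The indices of `J = {α₀, α₁, α₃, α₅}`. -/
def nodeJ : Fin 4 → Fin 7 := ![0, 1, 3, 5]

/-- The subgroup `W_J` of `W̃(E₆⁽¹⁾)` for `J = {α₀, α₁, α₃, α₅}`. -/
def WJ : Subgroup ExtE := parabolic diagramE _ (Set.range nodeJ)

/-- The subgroup `N_J = {w | w J = J}` of `W̃(E₆⁽¹⁾)` for `J = {α₀, α₁, α₃, α₅}`. -/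
def NJ : Subgroup ExtE := rootStabilizer diagramE _ (Set.range nodeJ)

/-- `b₀ = s₂s₃s₁s₂`, `b₁ = s₄s₅s₃s₄`, `b₂ = s₆s₀s₃s₆`. -/
def bE : Fin 3 → ExtE :=
  ![sE 2 * sE 3 * sE 1 * sE 2, sE 4 * sE 5 * sE 3 * sE 4, sE 6 * sE 0 * sE 3 * sE 6]

/-! The groups `W̃(A₂⁽¹⁾)` and `W(4A₁)`. -/

/-- The Dynkin diagram of type `A₂⁽¹⁾`: a triangle. -/
abbrev diagramA : SimpleGraph (Fin 3) := ⊤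

/-- The diagram automorphism `i ↦ i + 1` of `A₂⁽¹⁾`. -/
def sigmaDiagA : diagramA ≃g diagramA where
  toFun := ![1, 2, 0]
  invFun := ![2, 0, 1]
  left_inv := by decide
  right_inv := by decide
  map_rel_iff' := by decide

/-- The extended affine Weyl group `W̃(A₂⁽¹⁾) = W(A₂⁽¹⁾) ⋊ ⟨σ⟩`. -/
abbrev ExtA : Type := ExtWeyl diagramA (Subgroup.zpowers sigmaDiagA)

/-- The simple reflections of `W̃(A₂⁽¹⁾)`. -/
def sA (i : Fin 3) : ExtA := s diagramA _ i

/-- The element `σ` of `W̃(A₂⁽¹⁾)`. -/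
def sigmaA : ExtA := SemidirectProduct.inr ⟨sigmaDiagA, Subgroup.mem_zpowers _⟩

/-- The Dynkin diagram of type `4A₁`: four nodes and no bonds. -/
abbrev diagram4A1 : SimpleGraph (Fin 4) := ⊥

/-- The Weyl group `W(4A₁)`. -/
abbrev Weyl4A1 : Type := Weyl diagram4A1

end WeylNormalizer

end

open WeylNormalizer

/-! Everything is read off from the action on V. If ℓ(w s_i) > ℓ(w) then w α_i ≥ 0
(`weylAct_root_nonneg`), so the extended group acts faithfully on V (`act_injective`), and
identities in the group become computations with vectors.

The form (α_i, α_j) = a_ij is invariant, hence x s_j x⁻¹ is the reflection along x α_j. The roots of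
J are pairwise orthogonal, so W_J changes only their signs. If x normalises W_J, the reflections
along the x α_j lie in W_J, which forces x α_j ∈ ±J (`act_root_of_mem_normalizer`). An element of
W_J corrects the signs, which gives N(W_J) = N_J W_J. An element of N_J ∩ W_J fixes J and is
therefore trivial.

To generate N_J, strip off the power of σ, leaving w in the Weyl group with wJ = J. A descent i of w
is outside J, so i is one of 2, 4, 6, each joined to exactly two nodes of J. The corresponding b_a
is s_i s_j s_k s_i, up to the order of j and k, and w b_a is shorter than w
(`len_mul_lt_of_descent`). By induction w lies in ⟨b_0, b_1, b_2⟩.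

The relations of the extended group of type A₂⁽¹⁾ hold for the b_j and σ, so there is a homomorphism
from it onto N_J. It is injective because N_J acts on the orthogonal complement of J through a copy
of the representation of type A₂⁽¹⁾ (`act_extAHom`), which is faithful. The span of J plays the same
role for W(4A₁). -/

open WeylNormalizer

noncomputable section

namespace WeylNormalizer

/-! ### Lengths, signs of roots, and faithfulness of the action -/

section Tits

variable {B : Type} [DecidableEq B] (Γ : SimpleGraph B) [DecidableRel Γ.Adj]

theorem gen_mul_self (i : B) : gen Γ i * gen Γ i = 1 :=
  (coxMatrix Γ).toCoxeterSystem.simple_mul_simple_self i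

theorem gen_mul_gen_pow (i j : B) : (gen Γ i * gen Γ j) ^ (coxMatrix Γ) i j = 1 :=
  (coxMatrix Γ).toCoxeterSystem.simple_mul_simple_pow i j

theorem gen_comm {i j : B} (h : ¬ Γ.Adj i j) : gen Γ i * gen Γ j = gen Γ j * gen Γ i := by
  by_cases hij : i = j
  · rw [hij]
  · have h3 : coxMatrix Γ i j = 2 := by simp [coxMatrix, hij, h]
    have h1 := gen_mul_gen_pow Γ i j
    rw [h3, pow_two, mul_eq_one_iff_eq_inv, mul_inv_rev,
      inv_eq_of_mul_eq_one_left (gen_mul_self Γ i),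
      inv_eq_of_mul_eq_one_left (gen_mul_self Γ j)] at h1
    exact h1

theorem gen_braid {i j : B} (h : Γ.Adj i j) :
    gen Γ i * gen Γ j * gen Γ i = gen Γ j * gen Γ i * gen Γ j := by
  have h3 : coxMatrix Γ i j = 3 := by simp [coxMatrix, h.ne, h]
  have h1 := gen_mul_gen_pow Γ i j
  have h2 : (gen Γ i * gen Γ j * gen Γ i) * (gen Γ j * gen Γ i * gen Γ j) = 1 := by
    rw [← h1, h3]; simp only [pow_succ, pow_zero, one_mul, mul_assoc]
  rw [mul_eq_one_iff_eq_inv, mul_inv_rev, mul_inv_rev,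
    inv_eq_of_mul_eq_one_left (gen_mul_self Γ i),
    inv_eq_of_mul_eq_one_left (gen_mul_self Γ j)] at h2
  rw [h2, mul_assoc]

/-- The length function of `W(Γ)`. -/
def len (w : Weyl Γ) : ℕ := (coxMatrix Γ).toCoxeterSystem.length w

theorem len_mul_gen (w : Weyl Γ) (i : B) :
    len Γ (w * gen Γ i) = len Γ w + 1 ∨ len Γ (w * gen Γ i) + 1 = len Γ w :=
  (coxMatrix Γ).toCoxeterSystem.length_mul_simple w i

theorem mul_gen_mul_gen (w : Weyl Γ) (i : B) : w * gen Γ i * gen Γ i = w := by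
  rw [mul_assoc, gen_mul_self, mul_one]

theorem exists_len_mul_gen_lt {w : Weyl Γ} (hw : w ≠ 1) : ∃ i, len Γ (w * gen Γ i) < len Γ w :=
  (coxMatrix Γ).toCoxeterSystem.exists_rightDescent_of_ne_one hw

variable (A : Subgroup (Γ ≃g Γ))

theorem s_mul_self (i : B) : s Γ A i * s Γ A i = 1 := by
  rw [s, ← map_mul, gen_mul_self, map_one]

theorem s_comm {i j : B} (h : ¬ Γ.Adj i j) : s Γ A i * s Γ A j = s Γ A j * s Γ A i := by
  rw [s, s, ← map_mul, gen_comm Γ h, map_mul]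

theorem inr_mul_s (g : A) (i : B) :
    (SemidirectProduct.inr g : ExtWeyl Γ A) * s Γ A i =
      s Γ A ((g : Γ ≃g Γ) i) * SemidirectProduct.inr g := by
  have h : diagAut Γ g (gen Γ i) = gen Γ ((g : Γ ≃g Γ) i) := diagHom_gen Γ g i
  rw [s, s, ← h]
  exact (mul_inv_eq_iff_eq_mul.1 (SemidirectProduct.inl_aut (φ := (diagAut Γ).comp A.subtype) g _).symm)

variable [Fintype B]

theorem refl_root_self (i : B) : refl Γ i (root i) = - root i := by
  rw [refl_apply, coroot_self]; module

theorem refl_root_of_not_adj {i j : B} (hij : i ≠ j) (h : ¬ Γ.Adj i j) :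
    refl Γ j (root i) = root i := by
  rw [refl_apply, coroot_root]; simp [cartan, hij, h]

theorem refl_root_of_adj {i j : B} (h : Γ.Adj i j) : refl Γ j (root i) = root i + root j := by
  rw [refl_apply, coroot_root]; simp [cartan, h.ne, h]

theorem weylAct_mul_gen (w : Weyl Γ) (i : B) (v : B → ℝ) :
    weylAct Γ (w * gen Γ i) v = weylAct Γ w (refl Γ i v) := by
  rw [map_mul, weylAct_gen]; rfl

omit [Fintype B] [DecidableRel Γ.Adj] in
theorem root_nonneg (i : B) : 0 ≤ root i := Pi.single_nonneg.2 zero_le_one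

/-- If `ℓ(w s_i) > ℓ(w)`, then `w α_i` is a nonnegative combination of simple roots. -/
theorem weylAct_root_nonneg (w : Weyl Γ) (i : B) (h : len Γ w < len Γ (w * gen Γ i)) :
    0 ≤ weylAct Γ w (root i) := by
  induction hn : len Γ w using Nat.strong_induction_on generalizing w i with
  | _ n ih =>
  subst hn
  by_cases hw : w = 1
  · rw [hw, map_one]; exact root_nonneg i
  obtain ⟨j, hj⟩ := exists_len_mul_gen_lt Γ hw
  have hij : i ≠ j := by rintro rfl; exact lt_asymm h hj
  obtain ⟨v, rfl⟩ : ∃ v, w = v * gen Γ j := ⟨w * gen Γ j, (mul_gen_mul_gen Γ w j).symm⟩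
  rw [mul_gen_mul_gen] at hj
  have hvj : len Γ v < len Γ (v * gen Γ j) := hj
  have e1 := len_mul_gen Γ v j
  have e2 := len_mul_gen Γ v i
  by_cases ha : Γ.Adj i j
  · rw [weylAct_mul_gen, refl_root_of_adj Γ ha, map_add]
    rcases e2 with e2 | e2
    · exact add_nonneg (ih _ hj v i (by omega) rfl) (ih _ hj v j hj rfl)
    -- Now w = u s_i s_j with ℓ(w) = ℓ(u) + 2, and w α_i = u α_j. Were u s_j shorter than u, the
    -- braid relation w s_i = u s_j s_i s_j would give ℓ(w s_i) ≤ ℓ(u) + 1, against ℓ(w s_i) > ℓ(w).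
    · obtain ⟨u, rfl⟩ : ∃ u, v = u * gen Γ i := ⟨v * gen Γ i, (mul_gen_mul_gen Γ v i).symm⟩
      rw [mul_gen_mul_gen] at e2
      rw [← map_add, weylAct_mul_gen, map_add, refl_root_self, refl_root_of_adj Γ ha.symm]
      have e : - root i + (root j + root i) = (root j : B → ℝ) := by abel
      rw [e]
      refine ih _ (by omega) u j ?_ rfl
      by_contra hc
      have e3 := len_mul_gen Γ u j
      have e4 := len_mul_gen Γ (u * gen Γ j) i
      have e5 := len_mul_gen Γ (u * gen Γ j * gen Γ i) j
      have hb : u * gen Γ i * gen Γ j * gen Γ i = u * gen Γ j * gen Γ i * gen Γ j := by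
        simpa only [mul_assoc] using congrArg (u * ·) (gen_braid Γ ha)
      rw [hb] at h
      omega
  · rw [weylAct_mul_gen, refl_root_of_not_adj Γ hij ha]
    refine ih _ hj v i ?_ rfl
    by_contra hc
    have e3 := len_mul_gen Γ (v * gen Γ i) j
    have hb : v * gen Γ j * gen Γ i = v * gen Γ i * gen Γ j := by
      simpa only [mul_assoc] using congrArg (v * ·) (gen_comm Γ ha).symm
    rw [hb] at h
    omega

theorem weylAct_root_nonpos (w : Weyl Γ) (i : B) (h : len Γ (w * gen Γ i) < len Γ w) :
    weylAct Γ w (root i) ≤ 0 := by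
  have h1 := weylAct_root_nonneg Γ (w * gen Γ i) i (by rwa [mul_gen_mul_gen])
  rw [weylAct_mul_gen, refl_root_self, map_neg] at h1
  exact neg_nonneg.1 h1

theorem weylAct_root_nonneg_or_nonpos (w : Weyl Γ) (i : B) :
    0 ≤ weylAct Γ w (root i) ∨ weylAct Γ w (root i) ≤ 0 := by
  rcases len_mul_gen Γ w i with h | h
  · exact .inl (weylAct_root_nonneg Γ w i (by omega))
  · exact .inr (weylAct_root_nonpos Γ w i (by omega))

omit [Fintype B] [DecidableRel Γ.Adj] in
theorem root_ne_zero (i : B) : (root i : B → ℝ) ≠ 0 := by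
  simp [root]

omit [Fintype B] [DecidableRel Γ.Adj] in
theorem root_injective : Function.Injective (root : B → B → ℝ) := fun i j h => by
  by_contra hij
  have := congrFun h i
  simp [root, hij] at this

theorem len_mul_gen_lt_of_nonpos {w : Weyl Γ} {i : B} (h : weylAct Γ w (root i) ≤ 0) :
    len Γ (w * gen Γ i) < len Γ w := by
  by_contra hc
  have h1 := weylAct_root_nonneg Γ w i (by have := len_mul_gen Γ w i; omega)
  exact root_ne_zero i ((weylAct Γ w).map_eq_zero_iff.1 (le_antisymm h h1))

theorem act_inl (w : Weyl Γ) : act Γ A (SemidirectProduct.inl w) = weylAct Γ w :=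
  SemidirectProduct.lift_inl ..

theorem act_inr (g : A) : act Γ A (SemidirectProduct.inr g) = diagAct Γ g :=
  SemidirectProduct.lift_inr ..

theorem act_s (i : B) : act Γ A (s Γ A i) = refl Γ i := by
  rw [s, act_inl, weylAct_gen]

theorem act_mul_apply (x y : ExtWeyl Γ A) (v : B → ℝ) :
    act Γ A (x * y) v = act Γ A x (act Γ A y v) := by rw [map_mul]; rfl

/-- The extended Weyl group acts faithfully on `V`. -/
theorem act_injective : Function.Injective (act Γ A) := by
  rw [injective_iff_map_eq_one]
  intro x hx
  obtain ⟨w, g⟩ := x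
  rw [SemidirectProduct.mk_eq_inl_mul_inr] at hx ⊢
  -- If w g acts trivially then w sends simple roots to simple roots, so it has no descent.
  have hr : ∀ i, weylAct Γ w (root i) = root ((g⁻¹ : A).1 i) := fun i => by
    have h := congrArg (fun f => f (root ((g⁻¹ : A).1 i))) hx
    simp only [act_mul_apply, act_inl, act_inr, diagAct_root, LinearEquiv.coe_one, id] at h
    rwa [show (g : Γ ≃g Γ) ((g⁻¹ : A).1 i) = i from RelIso.apply_inv_self _ _] at h
  have hw : w = 1 := by
    by_contra hw
    obtain ⟨i, hi⟩ := exists_len_mul_gen_lt Γ hw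
    have h := weylAct_root_nonpos Γ w i hi
    rw [hr] at h
    exact root_ne_zero _ (le_antisymm h (root_nonneg _))
  have hg : g = 1 := by
    rw [← inv_eq_one]
    ext i
    have h := hr i
    rw [hw, map_one] at h
    exact (root_injective h).symm
  rw [hw, hg, map_one, map_one, one_mul]

end Tits


/-! ### The invariant form, reflections, and the stabiliser of J -/

section Form

variable {B : Type} [DecidableEq B] [Fintype B] (Γ : SimpleGraph B) [DecidableRel Γ.Adj]

/-- The invariant symmetric bilinear form on `V`, with `(α_i, α_j) = a_ij`. -/
def form : (B → ℝ) →ₗ[ℝ] (B → ℝ) →ₗ[ℝ] ℝ :=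
  ∑ i, (LinearMap.proj i : (B → ℝ) →ₗ[ℝ] ℝ).smulRight (coroot Γ i)

theorem coroot_apply (j : B) (v : B → ℝ) : coroot Γ j v = ∑ i, cartan Γ i j * v i := by
  simp [coroot, LinearMap.sum_apply]

theorem form_apply (v w : B → ℝ) : form Γ v w = ∑ i, v i * coroot Γ i w := by
  simp [form, LinearMap.sum_apply]

theorem form_root_left (j : B) (w : B → ℝ) : form Γ (root j) w = coroot Γ j w := by
  simp [form_apply, root, Pi.single_apply]

theorem form_comm (v w : B → ℝ) : form Γ v w = form Γ w v := by
  simp only [form_apply, coroot_apply, Finset.mul_sum]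
  rw [Finset.sum_comm]
  refine Finset.sum_congr rfl fun i _ => Finset.sum_congr rfl fun j _ => ?_
  rw [cartan_comm]; ring

theorem form_root_right (j : B) (w : B → ℝ) : form Γ w (root j) = coroot Γ j w := by
  rw [form_comm, form_root_left]

theorem form_refl (j : B) (v w : B → ℝ) : form Γ (refl Γ j v) (refl Γ j w) = form Γ v w := by
  simp only [refl_apply, map_sub, map_smul, LinearMap.sub_apply, LinearMap.smul_apply,
    form_root_left, form_root_right, coroot_self, smul_eq_mul]
  ring

theorem form_diagAct (g : Γ ≃g Γ) (v w : B → ℝ) :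
    form Γ (diagAct Γ g v) (diagAct Γ g w) = form Γ v w := by
  rw [form_apply, form_apply, ← Equiv.sum_comp g.toEquiv]
  refine Finset.sum_congr rfl fun i _ => ?_
  have e : diagAct Γ g v (g.toEquiv i) = v i := by
    rw [diagAct_apply]; exact congrArg v (RelIso.inv_apply_self g i)
  rw [e]
  exact congrArg (v i * ·) (coroot_diagAct Γ g i w)

variable (A : Subgroup (Γ ≃g Γ))

omit [Fintype B] in
theorem extWeyl_induction {p : ExtWeyl Γ A → Prop} (hs : ∀ i, p (s Γ A i))
    (hg : ∀ g : A, p (SemidirectProduct.inr g)) (hmul : ∀ x y, p x → p y → p (x * y))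
    (x : ExtWeyl Γ A) : p x := by
  obtain ⟨w, g⟩ := x
  rw [SemidirectProduct.mk_eq_inl_mul_inr]
  refine hmul _ _ ?_ (hg g)
  refine (coxMatrix Γ).toCoxeterSystem.simple_induction
    (p := fun w => p (SemidirectProduct.inl w)) w hs ?_ fun u v hu hv => ?_
  · simpa using hg 1
  · rw [map_mul]; exact hmul _ _ hu hv

theorem form_act (x : ExtWeyl Γ A) (v w : B → ℝ) :
    form Γ (act Γ A x v) (act Γ A x w) = form Γ v w := by
  induction x using extWeyl_induction generalizing v w with
  | hs i => rw [act_s, form_refl]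
  | hg g => rw [act_inr, form_diagAct]
  | hmul x y hx hy => rw [act_mul_apply, act_mul_apply, hx, hy]

theorem act_inv_apply (x : ExtWeyl Γ A) (v : B → ℝ) :
    act Γ A x (act Γ A x⁻¹ v) = v := by
  rw [← act_mul_apply, mul_inv_cancel, map_one]; rfl

/-- Invariance of the form turns a conjugate of s_j into the reflection along x α_j. -/
theorem act_conj_s (x : ExtWeyl Γ A) (j : B) (v : B → ℝ) :
    act Γ A (x * s Γ A j * x⁻¹) v =
      v - form Γ (act Γ A x (root j)) v • act Γ A x (root j) := by
  rw [act_mul_apply, act_mul_apply, act_s, refl_apply, map_sub, map_smul, act_inv_apply,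
    ← form_root_left, ← form_act Γ A x, act_inv_apply]

theorem conj_s_of_act_root {x : ExtWeyl Γ A} {j k : B} (h : act Γ A x (root j) = root k) :
    x * s Γ A j * x⁻¹ = s Γ A k := by
  refine act_injective Γ A (LinearEquiv.ext fun v => ?_)
  rw [act_conj_s, h, act_s, refl_apply, form_root_left]

theorem mem_rootStabilizer_iff {J : Set B} {x : ExtWeyl Γ A} :
    x ∈ rootStabilizer Γ A J ↔ act Γ A x '' (root '' J) = root '' J := Iff.rfl

theorem exists_act_root_eq {J : Set B} {x : ExtWeyl Γ A} (hx : x ∈ rootStabilizer Γ A J)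
    {j : B} (hj : j ∈ J) : ∃ k ∈ J, act Γ A x (root j) = root k := by
  have h : act Γ A x (root j) ∈ root '' J := by
    rw [← (mem_rootStabilizer_iff Γ A).1 hx]
    exact ⟨_, ⟨j, hj, rfl⟩, rfl⟩
  obtain ⟨k, hk, h⟩ := h
  exact ⟨k, hk, h.symm⟩

/-- J is finite and x acts injectively, so xJ ⊆ J already forces equality. -/
theorem mem_rootStabilizer_of_forall {J : Set B} {x : ExtWeyl Γ A}
    (h : ∀ j ∈ J, ∃ k ∈ J, act Γ A x (root j) = root k) : x ∈ rootStabilizer Γ A J := by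
  rw [mem_rootStabilizer_iff]
  refine Set.eq_of_subset_of_ncard_le ?_ ?_ (Set.toFinite _)
  · rintro _ ⟨_, ⟨j, hj, rfl⟩, rfl⟩
    obtain ⟨k, hk, e⟩ := h j hj
    exact ⟨k, hk, e.symm⟩
  · rw [Set.ncard_image_of_injective _ (act Γ A x).injective]

theorem rootStabilizer_le_normalizer (J : Set B) :
    rootStabilizer Γ A J ≤ Subgroup.normalizer (parabolic Γ A J : Set (ExtWeyl Γ A)) := by
  refine Subgroup.le_normalizer_closure_iff.2 ?_
  rintro x hx _ ⟨j, hj, rfl⟩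
  obtain ⟨k, hk, h⟩ := exists_act_root_eq Γ A hx hj
  rw [conj_s_of_act_root Γ A h]
  exact Subgroup.subset_closure ⟨k, hk, rfl⟩

theorem act_parabolic_sub_apply {J : Set B} {x : ExtWeyl Γ A} (hx : x ∈ parabolic Γ A J)
    (v : B → ℝ) {i : B} (hi : i ∉ J) : (act Γ A x v - v) i = 0 := by
  induction hx using Subgroup.closure_induction generalizing v with
  | mem x h =>
    obtain ⟨j, hj, rfl⟩ := h
    have hij : i ≠ j := by rintro rfl; exact hi hj
    simp [act_s, refl_apply, root, hij]
  | one => simp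
  | mul x y _ _ hx hy =>
    have h1 := hx (act Γ A y v)
    have h2 := hy v
    rw [act_mul_apply]
    simp only [Pi.sub_apply] at h1 h2 ⊢
    linarith
  | inv x _ hx =>
    have h1 := hx (act Γ A x⁻¹ v)
    rw [act_inv_apply] at h1
    simp only [Pi.sub_apply] at h1 ⊢
    linarith

/-! ### Normaliser of W_J for pairwise orthogonal J -/

section Orthogonal

variable {J : Set B} (hJ : ∀ i ∈ J, ∀ j ∈ J, ¬ Γ.Adj i j)
include hJ

theorem act_parabolic_root {x : ExtWeyl Γ A} (hx : x ∈ parabolic Γ A J) {j : B} (hj : j ∈ J) :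
    act Γ A x (root j) = root j ∨ act Γ A x (root j) = - root j := by
  induction hx using Subgroup.closure_induction with
  | mem x h =>
    obtain ⟨i, hi, rfl⟩ := h
    rw [act_s]
    by_cases hij : j = i
    · subst hij; exact .inr (refl_root_self Γ j)
    · exact .inl (refl_root_of_not_adj Γ hij (hJ j hj i hi))
  | one => left; simp
  | mul x y _ _ hx hy =>
    rw [act_mul_apply]
    rcases hy with hy | hy <;> rcases hx with hx | hx <;> simp [hx, hy]
  | inv x _ hx =>
    rcases hx with hx | hx
    · left; apply (act Γ A x).injective; rw [act_inv_apply, hx]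
    · right; apply (act Γ A x).injective; rw [act_inv_apply, map_neg, hx, neg_neg]

/-- On the span of J the form is twice the standard one. This supplies the nondegeneracy that the
form on all of V lacks in affine type. -/
theorem coroot_eq_of_support {u : B → ℝ} (hu : ∀ i ∉ J, u i = 0) {j : B} (hj : j ∈ J) :
    coroot Γ j u = 2 * u j := by
  rw [coroot_apply, Finset.sum_eq_single j]
  · simp [cartan]
  · intro i _ hij
    by_cases hi : i ∈ J
    · simp [cartan, hij, hJ i hi j hj]
    · simp [hu i hi]
  · simp

/-- An element of W_J sends each root of J to itself or its negative; preserving J excludes the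
negative. Then x v - v lies in the span of J and is orthogonal to J, so it vanishes. -/
theorem rootStabilizer_inf_parabolic : rootStabilizer Γ A J ⊓ parabolic Γ A J = ⊥ := by
  rw [eq_bot_iff]
  rintro x ⟨hx, hx'⟩
  have hfix : ∀ j ∈ J, act Γ A x (root j) = root j := by
    intro j hj
    rcases act_parabolic_root Γ A hJ hx' hj with h | h
    · exact h
    · obtain ⟨k, -, hk⟩ := exists_act_root_eq Γ A hx hj
      have h1 : 0 ≤ - (root j : B → ℝ) := by rw [← h, hk]; exact root_nonneg k
      exact absurd (le_antisymm (neg_nonneg.1 h1) (root_nonneg j)) (root_ne_zero j)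
  refine Subgroup.mem_bot.2 (act_injective Γ A ?_)
  rw [map_one]
  refine LinearEquiv.ext fun v => ?_
  rw [LinearEquiv.coe_one, id]
  refine sub_eq_zero.1 (funext fun j => ?_)
  have hsupp : ∀ i ∉ J, (act Γ A x v - v) i = 0 :=
    fun i hi => act_parabolic_sub_apply Γ A hx' v hi
  by_cases hj : j ∈ J
  · have h1 := coroot_eq_of_support Γ hJ hsupp hj
    have h2 := form_act Γ A x (root j) v
    rw [hfix j hj] at h2
    rw [← form_root_left, map_sub, h2, sub_self] at h1
    simpa using h1.symm
  · exact hsupp j hj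

theorem exists_parabolic_neg (S : Finset B) (hS : (S : Set B) ⊆ J) :
    ∃ u ∈ parabolic Γ A J, ∀ j ∈ J, act Γ A u (root j) = if j ∈ S then - root j else root j := by
  induction S using Finset.induction_on with
  | empty => exact ⟨1, one_mem _, by simp⟩
  | insert i S hi ih =>
    rw [Finset.coe_insert, Set.insert_subset_iff] at hS
    obtain ⟨u, hu, h⟩ := ih hS.2
    refine ⟨u * s Γ A i, mul_mem hu (Subgroup.subset_closure ⟨i, hS.1, rfl⟩), fun j hj => ?_⟩
    rw [act_mul_apply, act_s]
    by_cases hij : j = i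
    · subst hij
      rw [refl_root_self, map_neg, h j hj]; simp [hi]
    · rw [refl_root_of_not_adj Γ hij (hJ j hj i hS.1), h j hj]; simp [hij]

/-- The reflection along β = x α_j lies in W_J and sends β to -β, so β is in the span of J. For k
with β_k ≠ 0 the reflection moves α_k, hence negates it, so α_k is a multiple of β. Comparing
coordinates at k gives β_k = ±1. -/
theorem act_root_of_mem_normalizer {x : ExtWeyl Γ A}
    (hx : x ∈ Subgroup.normalizer (parabolic Γ A J : Set (ExtWeyl Γ A))) {j : B} (hj : j ∈ J) :
    ∃ k ∈ J, act Γ A x (root j) = root k ∨ act Γ A x (root j) = - root k := by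
  set β := act Γ A x (root j) with hβ
  have hmem : x * s Γ A j * x⁻¹ ∈ parabolic Γ A J :=
    (Subgroup.mem_normalizer_iff.1 hx _).1 (Subgroup.subset_closure ⟨j, hj, rfl⟩)
  have hβ2 : form Γ β β = 2 := by rw [hβ, form_act, form_root_left, coroot_self]
  have hsupp : ∀ i ∉ J, β i = 0 := fun i hi => by
    have h := act_parabolic_sub_apply Γ A hmem β hi
    rw [act_conj_s, ← hβ, hβ2] at h
    simpa using h
  obtain ⟨k, hk⟩ : ∃ k, β k * coroot Γ k β ≠ 0 := by
    by_contra! hc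
    rw [form_apply, Finset.sum_eq_zero fun k _ => hc k] at hβ2
    norm_num at hβ2
  have hkJ : k ∈ J := by
    by_contra hc
    simp [hsupp k hc] at hk
  have hc : coroot Γ k β = 2 * β k := coroot_eq_of_support Γ hJ hsupp hkJ
  have hk0 : β k ≠ 0 := left_ne_zero_of_mul hk
  have hβ0 : β ≠ 0 := fun h => hk0 (by rw [h]; rfl)
  have hprop : root k = β k • β := by
    have h := act_parabolic_root Γ A hJ hmem hkJ
    rw [act_conj_s, ← hβ, form_root_right, hc] at h
    rcases h with h | h
    · rw [sub_eq_self, smul_eq_zero] at h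
      rcases h with h | h
      · exact absurd h (mul_ne_zero two_ne_zero hk0)
      · exact absurd h hβ0
    · have h2 : (2 : ℝ) • root k = (2 : ℝ) • (β k • β) := by
        rw [smul_smul, two_smul]
        nth_rw 1 [sub_eq_iff_eq_add.1 h]
        abel
      exact smul_right_injective _ (two_ne_zero' ℝ) h2
  have h1 : β k * β k = 1 := by
    have := congrFun hprop k
    simpa [root] using this.symm
  refine ⟨k, hkJ, ?_⟩
  rcases mul_self_eq_one_iff.1 h1 with h | h
  · left; rw [hprop, h, one_smul]
  · right; rw [hprop, h]; simp

/-- The normaliser of a parabolic subgroup generated by commuting simple reflections. -/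
theorem isSemidirect_normalizer_parabolic :
    IsSemidirect (Subgroup.normalizer (parabolic Γ A J : Set (ExtWeyl Γ A)))
      (rootStabilizer Γ A J) (parabolic Γ A J) where
  left_le := rootStabilizer_le_normalizer Γ A J
  right_le := Subgroup.le_normalizer
  conj_mem k hk n hn := (Subgroup.mem_normalizer_iff.1 hk n).1 hn
  inf_eq_bot := rootStabilizer_inf_parabolic Γ A hJ
  sup_eq := by
    classical
    refine le_antisymm (sup_le (rootStabilizer_le_normalizer Γ A J) Subgroup.le_normalizer) ?_
    intro x hx
    -- u negates exactly those roots of J that x sends to negatives of roots of J, so x u preserves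
    -- J.
    obtain ⟨u, hu, hS⟩ := exists_parabolic_neg Γ A hJ
      (Finset.univ.filter fun j => j ∈ J ∧ ∃ k ∈ J, act Γ A x (root j) = - root k)
      (fun j hj => (Finset.mem_filter.1 (Finset.mem_coe.1 hj)).2.1)
    rw [← mul_inv_cancel_right x u]
    refine Subgroup.mul_mem_sup (mem_rootStabilizer_of_forall Γ A fun j hj => ?_) (inv_mem hu)
    rw [act_mul_apply, hS j hj]
    by_cases hn : ∃ k ∈ J, act Γ A x (root j) = - root k
    · rw [if_pos (by simpa using ⟨hj, hn⟩)]
      obtain ⟨k, hk, h⟩ := hn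
      exact ⟨k, hk, by rw [map_neg, h, neg_neg]⟩
    · rw [if_neg (by simpa using fun _ => by simpa using hn)]
      obtain ⟨k, hk, h | h⟩ := act_root_of_mem_normalizer Γ A hJ hx hj
      · exact ⟨k, hk, h⟩
      · exact absurd ⟨k, hk, h⟩ hn

end Orthogonal

/-- A descent step in `N_J`: if `w J = J`, the node `i` is joined to two nodes `j, k` of `J`, and
`w α_i` is negative, then `w` can be shortened by an element of type `A₃`. -/
theorem len_mul_lt_of_descent {J : Set B} {w : Weyl Γ}
    (hw : ∀ j ∈ J, ∃ k ∈ J, weylAct Γ w (root j) = root k) {i j k : B} (hj : j ∈ J) (hk : k ∈ J)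
    (hij : Γ.Adj i j) (hik : Γ.Adj i k) (hjk : j ≠ k) (hnjk : ¬ Γ.Adj j k)
    (hi : len Γ (w * gen Γ i) < len Γ w) :
    len Γ (w * gen Γ i * gen Γ j * gen Γ k * gen Γ i) < len Γ w := by
  have hneg : weylAct Γ w (root i) ≤ 0 := weylAct_root_nonpos Γ w i hi
  -- w s_i α_l = w α_i + α_m with α_m = w α_l and w α_i ≤ 0. Were the sum nonnegative, w α_i would
  -- be a multiple of α_m, making α_i a multiple of α_l.
  have key : ∀ l ∈ J, Γ.Adj i l → weylAct Γ (w * gen Γ i) (root l) ≤ 0 := by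
    intro l hl hil
    rcases weylAct_root_nonneg_or_nonpos Γ (w * gen Γ i) l with h | h
    · exfalso
      rw [weylAct_mul_gen, refl_root_of_adj Γ hil.symm, map_add] at h
      obtain ⟨m, -, hm⟩ := hw l hl
      rw [hm] at h
      have hp : ∃ c : ℝ, weylAct Γ w (root i) = c • root m := by
        refine ⟨weylAct Γ w (root i) m, funext fun n => ?_⟩
        by_cases hn : n = m
        · subst hn; simp [root]
        · have h1 := h n
          have h2 := hneg n
          simp only [Pi.add_apply, Pi.zero_apply, root, Pi.single_eq_of_ne hn] at h1
          simp only [Pi.zero_apply] at h2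
          simp only [root, Pi.smul_apply, Pi.single_eq_of_ne hn, smul_zero]
          exact le_antisymm h2 (by linarith)
      obtain ⟨c, hc⟩ := hp
      rw [← hm, ← map_smul] at hc
      have h3 := congrFun ((weylAct Γ w).injective hc) i
      simp [root, hil.ne] at h3
    · exact h
  have h1 : len Γ (w * gen Γ i * gen Γ j) < len Γ (w * gen Γ i) :=
    len_mul_gen_lt_of_nonpos Γ (key j hj hij)
  have h2 : len Γ (w * gen Γ i * gen Γ j * gen Γ k) < len Γ (w * gen Γ i * gen Γ j) := by
    refine len_mul_gen_lt_of_nonpos Γ ?_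
    rw [weylAct_mul_gen, refl_root_of_not_adj Γ hjk.symm fun h => hnjk h.symm]
    exact key k hk hik
  -- Three descents followed by at most one ascent: the length drops by at least two.
  have h3 := len_mul_gen Γ (w * gen Γ i * gen Γ j * gen Γ k) i
  omega

end Form


/-! ### The elements b_j and the structure of N_J in type E₆⁽¹⁾ -/

section TypeE

theorem refl_E1 (v : Fin 7 → ℝ) :
    refl diagramE 1 v = ![v 0, v 2 - v 1, v 2, v 3, v 4, v 5, v 6] := by
  ext k
  rw [refl_apply, coroot_apply, Fin.sum_univ_seven]
  fin_cases k <;> simp [cartan, diagramE, bondsE, root]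
  ring

theorem refl_E2 (v : Fin 7 → ℝ) :
    refl diagramE 2 v = ![v 0, v 1, v 1 + v 3 - v 2, v 3, v 4, v 5, v 6] := by
  ext k
  rw [refl_apply, coroot_apply, Fin.sum_univ_seven]
  fin_cases k <;> simp [cartan, diagramE, bondsE, root]
  ring

theorem refl_E3 (v : Fin 7 → ℝ) :
    refl diagramE 3 v = ![v 0, v 1, v 2, v 2 + v 4 + v 6 - v 3, v 4, v 5, v 6] := by
  ext k
  rw [refl_apply, coroot_apply, Fin.sum_univ_seven]
  fin_cases k <;> simp [cartan, diagramE, bondsE, root]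
  ring

theorem actE_b0 (v : Fin 7 → ℝ) : act diagramE (Subgroup.zpowers sigmaDiagE) (bE 0) v =
    ![v 0, v 3 - v 2, v 4 + v 6 - v 2, v 1 + v 4 + v 6 - v 2, v 4, v 5, v 6] := by
  rw [show bE 0 = sE 2 * sE 3 * sE 1 * sE 2 from rfl]
  simp only [sE, act_mul_apply, act_s, refl_E1, refl_E2, refl_E3]
  ext k
  fin_cases k <;> simp <;> ring

theorem sigmaE_mul_sE (i : Fin 7) : sigmaE * sE i = sE (sigmaDiagE i) * sigmaE :=
  inr_mul_s diagramE _ _ i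

/-- σ rotates the three arms of the diagram; the two middle letters of b_j commute, which absorbs
the difference in their order. Facts about b_1 and b_2 thus follow from those about b_0. -/
theorem sigmaE_conj_bE (i : Fin 3) : sigmaE * bE i * sigmaE⁻¹ = bE (i + 1) := by
  rw [mul_inv_eq_iff_eq_mul]
  have h05 : sE 3 * sE 5 = sE 5 * sE 3 := s_comm _ _ (by decide)
  have h00 : sE 3 * sE 0 = sE 0 * sE 3 := s_comm _ _ (by decide)
  have h01 : sE 3 * sE 1 = sE 1 * sE 3 := s_comm _ _ (by decide)
  have e0 : sigmaE * sE 0 = sE 1 * sigmaE := sigmaE_mul_sE 0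
  have e1 : sigmaE * sE 1 = sE 5 * sigmaE := sigmaE_mul_sE 1
  have e2 : sigmaE * sE 2 = sE 4 * sigmaE := sigmaE_mul_sE 2
  have e3 : sigmaE * sE 3 = sE 3 * sigmaE := sigmaE_mul_sE 3
  have e4 : sigmaE * sE 4 = sE 6 * sigmaE := sigmaE_mul_sE 4
  have e5 : sigmaE * sE 5 = sE 0 * sigmaE := sigmaE_mul_sE 5
  have e6 : sigmaE * sE 6 = sE 2 * sigmaE := sigmaE_mul_sE 6
  have key : ∀ a b c a' b' c' : ExtE, sigmaE * a = a' * sigmaE → sigmaE * b = b' * sigmaE →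
      sigmaE * c = c' * sigmaE →
      sigmaE * (a * b * c * a) = a' * b' * c' * a' * sigmaE := by
    intro a b c a' b' c' ha hb hc
    simp only [← mul_assoc]
    rw [ha, mul_assoc a', hb, mul_assoc a', mul_assoc b', hc, mul_assoc a', mul_assoc b',
      mul_assoc c', ha]
    simp only [mul_assoc]
  fin_cases i
  · have h := key _ _ _ _ _ _ e2 e3 e1
    rw [mul_assoc (sE 4), h05, ← mul_assoc] at h
    exact h
  · have h := key _ _ _ _ _ _ e4 e5 e3
    exact h
  · have h := key _ _ _ _ _ _ e6 e0 e3
    rw [mul_assoc (sE 2), ← h01, ← mul_assoc] at h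
    exact h

theorem actE_sigma (v : Fin 7 → ℝ) : act diagramE (Subgroup.zpowers sigmaDiagE) sigmaE v =
    ![v 5, v 0, v 6, v 3, v 2, v 1, v 4] := by
  rw [sigmaE, act_inr]
  ext k
  rw [diagAct_apply]
  fin_cases k <;> rfl

theorem actE_sigma_inv (v : Fin 7 → ℝ) : act diagramE (Subgroup.zpowers sigmaDiagE) sigmaE⁻¹ v =
    ![v 1, v 5, v 4, v 3, v 6, v 0, v 2] := by
  rw [sigmaE, ← map_inv, act_inr]
  ext k
  rw [diagAct_apply]
  fin_cases k <;> rfl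

theorem actE_b1 (v : Fin 7 → ℝ) : act diagramE (Subgroup.zpowers sigmaDiagE) (bE 1) v =
    ![v 0, v 1, v 2, v 5 + v 2 + v 6 - v 4, v 2 + v 6 - v 4, v 3 - v 4, v 6] := by
  rw [show bE 1 = sigmaE * bE 0 * sigmaE⁻¹ from (sigmaE_conj_bE 0).symm, act_mul_apply,
    act_mul_apply, actE_sigma_inv, actE_b0, actE_sigma]
  ext k
  fin_cases k <;> simp <;> ring

theorem actE_b2 (v : Fin 7 → ℝ) : act diagramE (Subgroup.zpowers sigmaDiagE) (bE 2) v =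
    ![v 3 - v 6, v 1, v 2, v 0 + v 2 + v 4 - v 6, v 4, v 5, v 2 + v 4 - v 6] := by
  rw [show bE 2 = sigmaE * bE 1 * sigmaE⁻¹ from (sigmaE_conj_bE 1).symm, act_mul_apply,
    act_mul_apply, actE_sigma_inv, actE_b1, actE_sigma]
  ext k
  fin_cases k <;> simp <;> ring

/-- By faithfulness the relations can be checked on coordinates in V. -/
theorem bE_liftable : (coxMatrix diagramA).IsLiftable bE := by
  intro i j
  refine act_injective diagramE _ (LinearEquiv.ext fun v => ?_)
  rw [map_one, LinearEquiv.coe_one, id]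
  fin_cases i <;> fin_cases j <;>
  · simp only [coxMatrix, Matrix.of_apply, Fin.zero_eta, Fin.mk_one, Fin.reduceFinMk,
      Fin.reduceEq, SimpleGraph.top_adj, if_true, if_false, ne_eq, not_false_eq_true, pow_succ,
      pow_zero, one_mul, act_mul_apply, actE_b0, actE_b1, actE_b2]
    ext k
    fin_cases k <;> simp <;> ring

theorem nodeJ_not_adj :
    ∀ i ∈ Set.range nodeJ, ∀ j ∈ Set.range nodeJ, ¬ diagramE.Adj i j := by
  rintro _ ⟨a, rfl⟩ _ ⟨b, rfl⟩
  revert a b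
  decide

theorem sigmaE_mem_NJ : sigmaE ∈ NJ := by
  refine mem_rootStabilizer_of_forall diagramE _ ?_
  have h : ∀ a, ∃ b, sigmaDiagE (nodeJ a) = nodeJ b := by decide
  rintro _ ⟨a, rfl⟩
  obtain ⟨b, hb⟩ := h a
  exact ⟨_, Set.mem_range_self b, by rw [← hb, sigmaE, act_inr, diagAct_root]⟩

theorem bE_mem_NJ (i : Fin 3) : bE i ∈ NJ := by
  have h0 : bE 0 ∈ NJ := by
    refine mem_rootStabilizer_of_forall diagramE _ ?_
    rintro _ ⟨a, rfl⟩
    -- b_0 exchanges α_1 and α_3 and fixes α_0 and α_5.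
    refine ⟨_, Set.mem_range_self (![0, 2, 1, 3] a), ?_⟩
    rw [actE_b0]
    ext k
    fin_cases a <;> fin_cases k <;> simp [nodeJ, root]
  have h : ∀ i, bE i ∈ NJ → bE (i + 1) ∈ NJ := fun i hi => by
    rw [← sigmaE_conj_bE]
    exact mul_mem (mul_mem sigmaE_mem_NJ hi) (inv_mem sigmaE_mem_NJ)
  have h1 : bE 1 ∈ NJ := by simpa using h 0 h0
  have h2 : bE 2 ∈ NJ := by simpa using h 1 h1
  match i with
  | 0 => exact h0
  | 1 => exact h1
  | 2 => exact h2

theorem inl_mem_closure_bE (w : Weyl diagramE) (hw : (SemidirectProduct.inl w : ExtE) ∈ NJ) :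
    (SemidirectProduct.inl w : ExtE) ∈ Subgroup.closure (Set.range bE) := by
  induction hn : len diagramE w using Nat.strong_induction_on generalizing w with
  | _ n ih =>
  subst hn
  by_cases h1 : w = 1
  · rw [h1, map_one]; exact one_mem _
  obtain ⟨i, hi⟩ := exists_len_mul_gen_lt diagramE h1
  have hwJ : ∀ j ∈ Set.range nodeJ, ∃ k ∈ Set.range nodeJ,
      weylAct diagramE w (root j) = root k := fun j hj => by
    rw [← act_inl diagramE (Subgroup.zpowers sigmaDiagE)]
    exact exists_act_root_eq _ _ hw hj
  have hiJ : i ∉ Set.range nodeJ := fun hc => by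
    obtain ⟨k, -, hk⟩ := hwJ i hc
    have h2 := weylAct_root_nonpos _ w i hi
    rw [hk] at h2
    exact root_ne_zero k (le_antisymm h2 (root_nonneg k))
  have step : ∀ (a : Fin 3) (j k : Fin 7), j ∈ Set.range nodeJ → k ∈ Set.range nodeJ →
      diagramE.Adj i j → diagramE.Adj i k → j ≠ k →
      sE i * sE j * sE k * sE i = bE a →
      (SemidirectProduct.inl w : ExtE) ∈ Subgroup.closure (Set.range bE) := by
    intro a j k hj hk hij hik hjk hb
    have hlt := len_mul_lt_of_descent diagramE hwJ hj hk hij hik hjk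
      (nodeJ_not_adj j hj k hk) hi
    have he : (SemidirectProduct.inl
        (w * gen diagramE i * gen diagramE j * gen diagramE k * gen diagramE i) : ExtE) =
        SemidirectProduct.inl w * bE a := by
      rw [← hb]
      simp only [map_mul, sE, s, mul_assoc]
    have h2 := ih _ hlt _ (he ▸ mul_mem hw (bE_mem_NJ a)) rfl
    rw [he] at h2
    exact (Subgroup.mul_mem_cancel_right _ (Subgroup.subset_closure (Set.mem_range_self a))).1 h2
  have h0 : (0 : Fin 7) ∈ Set.range nodeJ := ⟨0, rfl⟩
  have h1 : (1 : Fin 7) ∈ Set.range nodeJ := ⟨1, rfl⟩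
  have h3 : (3 : Fin 7) ∈ Set.range nodeJ := ⟨2, rfl⟩
  have h5 : (5 : Fin 7) ∈ Set.range nodeJ := ⟨3, rfl⟩
  fin_cases i
  · exact absurd h0 hiJ
  · exact absurd h1 hiJ
  · exact step 0 3 1 h3 h1 (by decide) (by decide) (by decide) rfl
  · exact absurd h3 hiJ
  · exact step 1 5 3 h5 h3 (by decide) (by decide) (by decide) rfl
  · exact absurd h5 hiJ
  · exact step 2 0 3 h0 h3 (by decide) (by decide) (by decide) rfl

theorem closure_bE_le_range_inl :
    Subgroup.closure (Set.range bE) ≤ (SemidirectProduct.inl : Weyl diagramE →* ExtE).range := by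
  rw [Subgroup.closure_le]
  have h : ∀ i, sE i ∈ (SemidirectProduct.inl : Weyl diagramE →* ExtE).range := fun i => ⟨_, rfl⟩
  rintro _ ⟨i, rfl⟩
  fin_cases i <;> exact mul_mem (mul_mem (mul_mem (h _) (h _)) (h _)) (h _)

theorem inr_mem_zpowers_sigmaE (g : Subgroup.zpowers sigmaDiagE) :
    (SemidirectProduct.inr g : ExtE) ∈ Subgroup.zpowers sigmaE := by
  obtain ⟨_, n, rfl⟩ := g
  exact ⟨n, by simp only [sigmaE]; rw [← map_zpow]; rfl⟩

theorem closure_bE_le_NJ : Subgroup.closure (Set.range bE) ≤ NJ := by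
  rw [Subgroup.closure_le]
  rintro _ ⟨i, rfl⟩
  exact bE_mem_NJ i

theorem zpowers_sigmaE_le_NJ : Subgroup.zpowers sigmaE ≤ NJ := by
  rw [Subgroup.zpowers_le]
  exact sigmaE_mem_NJ

theorem mem_NJ_decompose {x : ExtE} (hx : x ∈ NJ) :
    ∃ c ∈ Subgroup.closure (Set.range bE), ∃ g ∈ Subgroup.zpowers sigmaE, x = c * g := by
  have h : x = SemidirectProduct.inl x.left * SemidirectProduct.inr x.right := by simp
  refine ⟨_, inl_mem_closure_bE x.left ?_, _, inr_mem_zpowers_sigmaE x.right, h⟩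
  rw [h] at hx
  exact (Subgroup.mul_mem_cancel_right _
    (zpowers_sigmaE_le_NJ (inr_mem_zpowers_sigmaE x.right))).1 hx

theorem zpowers_sigmaE_le_normalizer : Subgroup.zpowers sigmaE ≤
    Subgroup.normalizer (Subgroup.closure (Set.range bE) : Set ExtE) := by
  rw [Subgroup.zpowers_le]
  refine Subgroup.normalizer_le_normalizer_closure _ ?_
  rw [Subgroup.mem_normalizer_iff_conj_image_eq, ← Set.range_comp]
  have h : (MulAut.conj sigmaE : ExtE → ExtE) ∘ bE = bE ∘ Equiv.addRight 1 :=
    funext sigmaE_conj_bE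
  rw [h, EquivLike.range_comp]

theorem isSemidirect_NJ : IsSemidirect NJ (Subgroup.zpowers sigmaE)
    (Subgroup.closure (Set.range bE)) where
  left_le := zpowers_sigmaE_le_NJ
  right_le := closure_bE_le_NJ
  conj_mem k hk n hn := by
    obtain ⟨c, hc, g, hg, rfl⟩ := mem_NJ_decompose hk
    exact (Subgroup.mem_normalizer_iff.1
      (mul_mem (Subgroup.le_normalizer hc) (zpowers_sigmaE_le_normalizer hg)) n).1 hn
  inf_eq_bot := by
    rw [eq_bot_iff]
    rintro x ⟨⟨n, rfl⟩, hx⟩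
    obtain ⟨w, hw⟩ := closure_bE_le_range_inl hx
    have h1 := congrArg SemidirectProduct.left hw
    simp only [sigmaE] at h1
    rw [← map_zpow, SemidirectProduct.left_inl, SemidirectProduct.left_inr] at h1
    rw [Subgroup.mem_bot, ← hw, h1, map_one]
  sup_eq := by
    refine le_antisymm (sup_le zpowers_sigmaE_le_NJ closure_bE_le_NJ) fun x hx => ?_
    obtain ⟨c, hc, g, hg, rfl⟩ := mem_NJ_decompose hx
    exact mul_mem (Subgroup.mem_sup_right hc) (Subgroup.mem_sup_left hg)

end TypeE


/-! ### From internal to external semidirect products -/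

/-- An internal semidirect product is isomorphic to the external one, along given parametrisations
of its two factors. -/
theorem IsSemidirect.exists_mulEquiv {G H' N' : Type*} [Group G] [Group H'] [Group N']
    {K H N : Subgroup G} (h : IsSemidirect K H N) (e : N' →* G) (he : Function.Injective e)
    (hN : e.range = N) (f : H' →* G) (hf : Function.Injective f) (hH : f.range = H) :
    ∃ (φ : H' →* MulAut N') (F : N' ⋊[φ] H' ≃* K),
      (∀ x, (F (SemidirectProduct.inr x) : G) = f x) ∧
      (∀ n, (F (SemidirectProduct.inl n) : G) = e n) := by
  subst hN hH
  have hn : f.range ≤ Subgroup.normalizer (e.range : Set G) :=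
    Subgroup.le_normalizer_iff.2 fun k hk n hn => h.conj_mem k (h.left_le hk) n hn
  let e' : N' ≃* e.range := MonoidHom.ofInjective he
  let f' : H' →* Subgroup.normalizer (e.range : Set G) :=
    f.codRestrict _ fun x => hn ⟨x, rfl⟩
  let φ : H' →* MulAut N' :=
    (MulAut.congr e'.symm).toMonoidHom.comp (e.range.normalizerMonoidHom.comp f')
  have key : ∀ x n, e (φ x n) = f x * e n * (f x)⁻¹ := fun x n => by
    have h1 : e' (φ x n) = e.range.normalizerMonoidHom (f' x) (e' n) :=
      e'.apply_symm_apply _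
    exact congrArg Subtype.val h1
  let F : N' ⋊[φ] H' →* G := SemidirectProduct.lift e f fun x => MonoidHom.ext fun n => key x n
  have hFl : ∀ n, F (SemidirectProduct.inl n) = e n := fun n => SemidirectProduct.lift_inl ..
  have hFr : ∀ x, F (SemidirectProduct.inr x) = f x := fun n => SemidirectProduct.lift_inr ..
  have hF : Function.Injective F := by
    rw [injective_iff_map_eq_one]
    rintro ⟨n, x⟩ hx
    rw [SemidirectProduct.mk_eq_inl_mul_inr] at hx ⊢
    rw [map_mul, hFl, hFr] at hx
    have h1 : f x ∈ f.range ⊓ e.range :=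
      ⟨⟨x, rfl⟩, n⁻¹, (map_inv e n).trans (eq_inv_of_mul_eq_one_right hx).symm⟩
    rw [h.inf_eq_bot, Subgroup.mem_bot] at h1
    rw [h1, mul_one] at hx
    rw [(injective_iff_map_eq_one _).1 hf _ h1, (injective_iff_map_eq_one _).1 he _ hx]
    simp
  have hK : F.range = K := by
    rw [← h.sup_eq]
    refine le_antisymm ?_ (sup_le ?_ ?_)
    · rintro _ ⟨⟨n, x⟩, rfl⟩
      rw [SemidirectProduct.mk_eq_inl_mul_inr, map_mul, hFl, hFr]
      exact mul_mem (Subgroup.mem_sup_right ⟨n, rfl⟩) (Subgroup.mem_sup_left ⟨x, rfl⟩)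
    · rintro _ ⟨x, rfl⟩
      exact ⟨_, hFr x⟩
    · rintro _ ⟨n, rfl⟩
      exact ⟨_, hFl n⟩
  exact ⟨φ, (MonoidHom.ofInjective hF).trans (MulEquiv.subgroupCongr hK), hFr, hFl⟩

/-! ### Identification of N_J with the extended group of type A₂⁽¹⁾ -/

section TypeA

theorem sigmaE_pow_three : sigmaE ^ 3 = 1 := by
  rw [sigmaE, ← map_pow, ← map_one SemidirectProduct.inr]
  congr 1
  ext i
  revert i
  decide

/-- The rotation of the triangle, as a generator of the group of diagram automorphisms. -/
def rotA : Subgroup.zpowers sigmaDiagA := ⟨sigmaDiagA, Subgroup.mem_zpowers _⟩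

theorem rotA_pow_three : rotA ^ 3 = 1 := by
  ext i
  revert i
  decide

theorem orderOf_rotA : orderOf rotA = 3 := by
  refine orderOf_eq_prime rotA_pow_three fun h => ?_
  have h1 : sigmaDiagA 0 = 0 := congrArg (fun g : Subgroup.zpowers sigmaDiagA => g.1 0) h
  revert h1
  decide

theorem mem_zpowers_rotA (g : Subgroup.zpowers sigmaDiagA) : g ∈ Subgroup.zpowers rotA := by
  obtain ⟨_, n, rfl⟩ := g
  exact ⟨n, rfl⟩

theorem rotA_induction {p : Subgroup.zpowers sigmaDiagA → Prop} (one : p 1)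
    (mul : ∀ g, p g → p (rotA * g)) (g : Subgroup.zpowers sigmaDiagA) : p g := by
  have hfin : IsOfFinOrder rotA := isOfFinOrder_iff_pow_eq_one.2 ⟨3, by norm_num, rotA_pow_three⟩
  obtain ⟨n, rfl⟩ := hfin.mem_powers_iff_mem_zpowers.2 (mem_zpowers_rotA g)
  change p (rotA ^ n)
  induction n with
  | zero => simpa using one
  | succ n ih => rw [pow_succ']; exact mul _ ih

/-- The homomorphism `⟨ρ⟩ → W̃(E₆⁽¹⁾)` with `ρ ↦ σ`. -/
def rotHom : Subgroup.zpowers sigmaDiagA →* ExtE :=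
  monoidHomOfForallMemZpowers mem_zpowers_rotA
    (by rw [orderOf_rotA]; exact orderOf_dvd_of_pow_eq_one sigmaE_pow_three)

theorem rotHom_rotA : rotHom rotA = sigmaE := monoidHomOfForallMemZpowers_apply_gen ..

/-- The homomorphism `W(A₂⁽¹⁾) → W̃(E₆⁽¹⁾)` with `r_j ↦ b_j`. -/
def weylAHom : Weyl diagramA →* ExtE :=
  (coxMatrix diagramA).toCoxeterSystem.lift ⟨bE, bE_liftable⟩

theorem weylAHom_gen (i : Fin 3) : weylAHom (gen diagramA i) = bE i :=
  (coxMatrix diagramA).toCoxeterSystem.lift_apply_simple bE_liftable i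

theorem rotHom_conj_bE (g : Subgroup.zpowers sigmaDiagA) (i : Fin 3) :
    rotHom g * bE i * (rotHom g)⁻¹ = bE (g.1 i) := by
  induction g using rotA_induction with
  | one => simp
  | mul g ih =>
    have h : ∀ i : Fin 3, i + 1 = sigmaDiagA i := by decide
    rw [map_mul, rotHom_rotA, mul_inv_rev]
    calc _ = sigmaE * (rotHom g * bE i * (rotHom g)⁻¹) * sigmaE⁻¹ := by simp only [mul_assoc]
      _ = _ := by rw [ih, sigmaE_conj_bE, h]; rfl

/-- The homomorphism `W̃(A₂⁽¹⁾) → W̃(E₆⁽¹⁾)` with `r_j ↦ b_j` and `ρ ↦ σ`. -/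
def extAHom : ExtA →* ExtE :=
  SemidirectProduct.lift weylAHom rotHom fun g => weyl_hom_ext diagramA fun i => by
    have h : ((diagAut diagramA).comp (Subgroup.zpowers sigmaDiagA).subtype) g (gen diagramA i) =
      gen diagramA (g.1 i) := diagHom_gen diagramA g.1 i
    simp only [MonoidHom.comp_apply, MulEquiv.coe_toMonoidHom, MulAut.conj_apply] at h ⊢
    rw [h, weylAHom_gen, weylAHom_gen, rotHom_conj_bE]

theorem extAHom_sA (i : Fin 3) : extAHom (sA i) = bE i :=
  (SemidirectProduct.lift_inl ..).trans (weylAHom_gen i)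

theorem extAHom_inr (g : Subgroup.zpowers sigmaDiagA) :
    extAHom (SemidirectProduct.inr g) = rotHom g :=
  SemidirectProduct.lift_inr ..

theorem extAHom_sigmaA : extAHom sigmaA = sigmaE :=
  (extAHom_inr rotA).trans rotHom_rotA

/-- The map `V(A₂⁽¹⁾) → V(E₆⁽¹⁾)` with `α₀ ↦ 2α₂ + α₁ + α₃`, `α₁ ↦ 2α₄ + α₅ + α₃` and
`α₂ ↦ 2α₆ + α₀ + α₃`. -/
def embA (v : Fin 3 → ℝ) : Fin 7 → ℝ :=
  ![v 2, v 0, 2 * v 0, v 0 + v 1 + v 2, 2 * v 1, v 1, 2 * v 2]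

theorem embA_injective : Function.Injective embA := fun v w h => by
  ext k
  fin_cases k
  exacts [congrFun h 1, congrFun h 5, congrFun h 0]

/-- The images of the simple roots under `embA` are orthogonal to J and have Gram matrix twice the
Cartan matrix of A₂⁽¹⁾; b_j acts on their span as the reflection along the j-th one, and σ permutes
them cyclically. -/
theorem act_extAHom (x : ExtA) (v : Fin 3 → ℝ) :
    act diagramE (Subgroup.zpowers sigmaDiagE) (extAHom x) (embA v) =
      embA (act diagramA (Subgroup.zpowers sigmaDiagA) x v) := by
  induction x using extWeyl_induction generalizing v with
  | hs i =>
    rw [show s diagramA (Subgroup.zpowers sigmaDiagA) i = sA i from rfl, extAHom_sA, sA, act_s,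
      refl_apply, coroot_apply, Fin.sum_univ_three]
    ext k
    fin_cases i <;> simp only [Fin.zero_eta, Fin.mk_one, Fin.reduceFinMk, actE_b0, actE_b1,
      actE_b2] <;> fin_cases k <;> simp [embA, cartan, root] <;> ring
  | hg g =>
    induction g using rotA_induction generalizing v with
    | one => simp
    | mul g ih =>
      rw [map_mul, map_mul, act_mul_apply, act_mul_apply, ih, extAHom_inr, rotHom_rotA,
        actE_sigma, act_inr diagramA _ rotA]
      ext k
      -- Only the coefficient of α_3 is not definitional: it is the sum of the three coordinates,
      -- cyclically permuted.
      fin_cases k <;> first | rfl | skip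
      simp only [embA]
      change _ + _ + _ = _ + _ + _
      generalize act diagramA (Subgroup.zpowers sigmaDiagA) (SemidirectProduct.inr g) v = u
      change u 0 + u 1 + u 2 = u 2 + u 0 + u 1
      ring
  | hmul x y hx hy => rw [map_mul, act_mul_apply, act_mul_apply, hy, hx]

theorem extAHom_injective : Function.Injective extAHom := fun x y h =>
  act_injective diagramA _ <| LinearEquiv.ext fun v => embA_injective <| by
    rw [← act_extAHom, ← act_extAHom, h]

theorem range_extAHom : extAHom.range = NJ := by
  apply le_antisymm
  · rintro _ ⟨x, rfl⟩
    induction x using extWeyl_induction with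
    | hs i => exact extAHom_sA i ▸ bE_mem_NJ i
    | hg g =>
      induction g using rotA_induction with
      | one => rw [map_one, map_one]; exact one_mem _
      | mul g ih =>
        rw [map_mul, map_mul, extAHom_inr rotA, rotHom_rotA]
        exact mul_mem sigmaE_mem_NJ ih
    | hmul x y hx hy => rw [map_mul]; exact mul_mem hx hy
  · rw [← isSemidirect_NJ.sup_eq, sup_le_iff, Subgroup.zpowers_le, Subgroup.closure_le]
    refine ⟨⟨_, extAHom_sigmaA⟩, ?_⟩
    rintro _ ⟨i, rfl⟩
    exact ⟨_, extAHom_sA i⟩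

end TypeA

/-! ### Identification of W_J with W(4A₁) -/

section Type4A1

theorem sE_nodeJ_liftable : (coxMatrix diagram4A1).IsLiftable fun k => sE (nodeJ k) := by
  intro i j
  by_cases hij : i = j
  · subst hij
    rw [CoxeterMatrix.diagonal, pow_one]
    exact s_mul_self ..
  · have h : coxMatrix diagram4A1 i j = 2 := by simp [coxMatrix, hij]
    have hc : sE (nodeJ i) * sE (nodeJ j) = sE (nodeJ j) * sE (nodeJ i) :=
      s_comm _ _ (nodeJ_not_adj _ ⟨i, rfl⟩ _ ⟨j, rfl⟩)
    have h1 : ∀ a, sE a * sE a = 1 := fun a => s_mul_self ..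
    rw [h, pow_two]
    nth_rw 2 [hc]
    rw [mul_assoc, ← mul_assoc (sE (nodeJ j)), h1, one_mul, h1]

/-- The homomorphism `W(4A₁) → W̃(E₆⁽¹⁾)` onto `W_J`. -/
def weyl4A1Hom : Weyl4A1 →* ExtE :=
  (coxMatrix diagram4A1).toCoxeterSystem.lift ⟨_, sE_nodeJ_liftable⟩

theorem weyl4A1Hom_gen (k : Fin 4) : weyl4A1Hom (gen diagram4A1 k) = sE (nodeJ k) :=
  (coxMatrix diagram4A1).toCoxeterSystem.lift_apply_simple sE_nodeJ_liftable k

theorem weyl4A1_induction {p : Weyl4A1 → Prop} (hs : ∀ k, p (gen diagram4A1 k)) (one : p 1)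
    (mul : ∀ x y, p x → p y → p (x * y)) (x : Weyl4A1) : p x :=
  (coxMatrix diagram4A1).toCoxeterSystem.simple_induction x hs one mul

/-- The map `V(4A₁) → V(E₆⁽¹⁾)` sending the simple roots to `J`. -/
def emb4A1 (v : Fin 4 → ℝ) : Fin 7 → ℝ := ![v 0, v 1, 0, v 2, 0, v 3, 0]

theorem emb4A1_injective : Function.Injective emb4A1 := fun v w h => by
  ext k
  fin_cases k
  exacts [congrFun h 0, congrFun h 1, congrFun h 3, congrFun h 5]

theorem act_weyl4A1Hom (x : Weyl4A1) (v : Fin 4 → ℝ) :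
    act diagramE (Subgroup.zpowers sigmaDiagE) (weyl4A1Hom x) (emb4A1 v) =
      emb4A1 (weylAct diagram4A1 x v) := by
  induction x using weyl4A1_induction generalizing v with
  | hs i =>
    rw [weyl4A1Hom_gen, sE, act_s, weylAct_gen, refl_apply, refl_apply, coroot_apply,
      coroot_apply, Fin.sum_univ_four, Fin.sum_univ_seven]
    ext k
    fin_cases i <;> fin_cases k <;>
      simp [emb4A1, cartan, root, nodeJ, diagramE, bondsE]
  | one => simp
  | mul x y hx hy =>
    rw [map_mul, act_mul_apply, hy, hx, map_mul]; rfl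

theorem weyl4A1Hom_injective : Function.Injective weyl4A1Hom := fun x y h =>
  -- Faithfulness was proved for extended groups; the trivial group of diagram automorphisms
  -- recovers the plain Weyl group.
  SemidirectProduct.inl_injective <| act_injective diagram4A1 ⊥ <| by
    rw [act_inl, act_inl]
    exact LinearEquiv.ext fun v => emb4A1_injective <| by
      rw [← act_weyl4A1Hom, ← act_weyl4A1Hom, h]

theorem range_weyl4A1Hom : weyl4A1Hom.range = WJ := by
  apply le_antisymm
  · rintro _ ⟨x, rfl⟩
    induction x using weyl4A1_induction with
    | hs k =>
      rw [weyl4A1Hom_gen]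
      exact Subgroup.subset_closure ⟨_, ⟨k, rfl⟩, rfl⟩
    | one => rw [map_one]; exact one_mem _
    | mul x y hx hy => rw [map_mul]; exact mul_mem hx hy
  · refine (Subgroup.closure_le _).2 ?_
    rintro _ ⟨_, ⟨k, rfl⟩, rfl⟩
    exact ⟨_, weyl4A1Hom_gen k⟩

end Type4A1

end WeylNormalizer

end

theorem mainTheorem4 :
    -- `N(W_J) = N_J ⋉ W_J`
    IsSemidirect (Subgroup.normalizer (WJ : Set ExtE)) NJ WJ ∧
    -- `N_J = ⟨b₁, b₂, b₀⟩ ⋊ ⟨σ⟩`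
    IsSemidirect NJ (Subgroup.zpowers sigmaE) (Subgroup.closure {bE 1, bE 2, bE 0}) ∧
    -- `N(W_J) ≅ W̃(A₂⁽¹⁾) ⋉ W(4A₁)`, compatibly with the generators
    ∃ (φ : ExtA →* MulAut Weyl4A1)
      (F : Weyl4A1 ⋊[φ] ExtA ≃* Subgroup.normalizer (WJ : Set ExtE)),
      (∀ i : Fin 3, (F (SemidirectProduct.inr (sA i)) : ExtE) = bE i) ∧
      (F (SemidirectProduct.inr sigmaA) : ExtE) = sigmaE ∧
      (∀ k : Fin 4, (F (SemidirectProduct.inl (gen diagram4A1 k)) : ExtE) = sE (nodeJ k)) := by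
  have hN : IsSemidirect (Subgroup.normalizer (WJ : Set ExtE)) NJ WJ :=
    isSemidirect_normalizer_parabolic diagramE _ nodeJ_not_adj
  have hb : ({bE 1, bE 2, bE 0} : Set ExtE) = Set.range bE := by
    ext x
    simp only [Set.mem_insert_iff, Set.mem_singleton_iff, Set.mem_range, Fin.exists_fin_succ,
      IsEmpty.exists_iff, eq_comm (a := x)]
    tauto
  refine ⟨hN, hb ▸ isSemidirect_NJ, ?_⟩
  obtain ⟨φ, F, hr, hl⟩ := hN.exists_mulEquiv weyl4A1Hom weyl4A1Hom_injective range_weyl4A1Hom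
    extAHom extAHom_injective range_extAHom
  exact ⟨φ, F, fun i => (hr _).trans (extAHom_sA i), (hr _).trans extAHom_sigmaA,
    fun k => (hl _).trans (weyl4A1Hom_gen k)⟩
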